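/- Let $K$ be a field of characteristic zero and let $\tilde E/K$ be a finite Galois extension with $\Gamma=\mathrm{Gal}(\tilde E/K)$. For a finite Galois extension $F/K$ with group $A=\mathrm{Gal}(F/K)$ and an $A$-group $N$ (a group on which $A$ acts by automorphisms, written $\ast$), let $A$ act on the group algebra $F[N]$ through Galois automorphisms on the coefficients and through $\ast$ on $N$; its fixed points $F[N]^A$ form a $K$-algebra. For a finite $\Gamma$-group $N$, write $\widehat N=\mathrm{Hom}(N,\tilde E^\times)$ for the set of characters of $N$, a $\Gamma$-set via $(\gamma\ast\chi)(\eta)=\gamma\bigl(\chi(\gamma^{-1}\ast\eta)\bigr)$. Two $\Gamma$-sets are isomorphic if there is a $\Gamma$-equivariant bijection between them. (1) Let $N_1,N_2$ be finite abelian $\Gamma$-groups, and suppose that $\tilde E$ contains a primitive $e$-th root of unity, where $e$ is the least common multiple of the exponents of $N_1$ and $N_2$. Then $\tilde E[N_1]^\Gamma\cong\tilde E[N_2]^\Gamma$ as $K$-algebras if and only if $\widehat{N_1}\cong\widehat{N_2}$ as $\Gamma$-sets. (2) Let $L/K$ be a finite extension with Galois closure $E$, let $G=\mathrm{Gal}(E/K)$,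 $G_L=\mathrm{Gal}(E/L)$, $X=G/G_L$ (left cosets), and let $\lambda:G\to\mathrm{Perm}(X)$ be the action by left translation. Let $N_1,N_2$ be regular subgroups of $\mathrm{Perm}(X)$ (of the same size as $X$ and transitive on $X$) that are stable under the action $\sigma\ast\eta=\lambda(\sigma)\eta\lambda(\sigma)^{-1}$ of $G$; by the theorem of Greither and Pareigis, the algebras $E[N]^G$ for such $N$ are exactly the underlying algebras of the Hopf algebras giving the Hopf–Galois structures on $L/K$. Suppose that $E[N_1]^G$ and $E[N_2]^G$ are commutative, that $\tilde E\supseteq E$, and that $\tilde E$ contains a primitive $e$-th root of unity, where $e$ is the least common multiple of the exponents of $N_1$ and $N_2$. Let $\Gamma$ act on $N_1,N_2$ through the restriction map $\Gamma\to G$. Then $E[N_1]^G\cong E[N_2]^G$ as $K$-algebras if and only if $\widehat{N_1}\cong\widehat{N_2}$ as $\Gamma$-sets. -/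

import Mathlib

/-- For a field extension `E/K` with `G = Gal(E/K)` and a `G`-group `N` (given by a homomorphism
`φ : G → Aut N`), the action of `g ∈ G` on the group algebra `E[N]`: Galois automorphism on the
coefficients, `φ g` on the group elements. -/
noncomputable def groupAlgebraAct {K E N : Type*} [Field K] [Field E] [Algebra K E] [Group N]
    (φ : Gal(E/K) →* MulAut N) (g : Gal(E/K)) :
    MonoidAlgebra E N →ₐ[K] MonoidAlgebra E N :=
  (MonoidAlgebra.mapDomainAlgHom K E (φ g).toMonoidHom).comp
    (MonoidAlgebra.mapAlgHom N (g : E →ₐ[K] E))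

theorem groupAlgebraAct_single {K E N : Type*} [Field K] [Field E] [Algebra K E] [Group N]
    (φ : Gal(E/K) →* MulAut N) (g : Gal(E/K)) (η : N) (a : E) :
    groupAlgebraAct φ g (MonoidAlgebra.single η a) = MonoidAlgebra.single (φ g η) (g a) := by
  simp [groupAlgebraAct]

/-- The fixed points `E[N]^G`, as a `K`-subalgebra of `E[N]`. -/
noncomputable def fixedAlgebra {K E N : Type*} [Field K] [Field E] [Algebra K E] [Group N]
    (φ : Gal(E/K) →* MulAut N) : Subalgebra K (MonoidAlgebra E N) :=
  ⨅ g : Gal(E/K), AlgHom.equalizer (groupAlgebraAct φ g) (AlgHom.id K (MonoidAlgebra E N))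

theorem mem_fixedAlgebra {K E N : Type*} [Field K] [Field E] [Algebra K E] [Group N]
    (φ : Gal(E/K) →* MulAut N) (x : MonoidAlgebra E N) :
    x ∈ fixedAlgebra φ ↔ ∀ g : Gal(E/K), groupAlgebraAct φ g x = x := by
  simp [fixedAlgebra, Algebra.mem_iInf]

/-- The action of `Gal(E/K)` on the characters `N → Eˣ`:
`(g ∗ χ)(η) = g (χ (g⁻¹ ∗ η))`. -/
def dualAct {K E N : Type*} [Field K] [Field E] [Algebra K E] [Group N]
    (φ : Gal(E/K) →* MulAut N) : Gal(E/K) →* Equiv.Perm (N →* Eˣ) :=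
  MonoidHom.toHomPerm
    { toFun := fun g χ =>
        ((Units.map (g : E →* E)).comp χ).comp (φ g⁻¹).toMonoidHom
      map_one' := by
        funext χ
        ext η
        simp
        rfl
      map_mul' := fun g h => by
        funext χ
        ext η
        simp
        rfl }

theorem dualAct_apply {K E N : Type*} [Field K] [Field E] [Algebra K E] [Group N]
    (φ : Gal(E/K) →* MulAut N) (g : Gal(E/K)) (χ : N →* Eˣ) (η : N) :
    ((dualAct φ g χ η : Eˣ) : E) = g ((χ (φ g⁻¹ η) : Eˣ) : E) := rfl

/-- Two `G`-sets, given by homomorphisms into permutation groups, are isomorphic if there is a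
`G`-equivariant bijection between them. -/
def IsomorphicGSets {G S T : Type*} [Group G]
    (a : G →* Equiv.Perm S) (b : G →* Equiv.Perm T) : Prop :=
  ∃ f : S ≃ T, ∀ (g : G) (s : S), f (a g s) = b g (f s)

/-- `G_L = Gal(E/L)` as a subgroup of `G = Gal(E/K)`, for a tower `K ⊆ L ⊆ E`. -/
def galSubgroup (K L E : Type*) [Field K] [Field L] [Field E] [Algebra K L] [Algebra K E]
    [Algebra L E] [IsScalarTower K L E] : Subgroup Gal(E/K) :=
  (IsScalarTower.toAlgHom K L E).fieldRange.fixingSubgroup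

/-- The left translation homomorphism `G → Perm X`, where `X = G / G_L`. -/
def leftTranslation (K L E : Type*) [Field K] [Field L] [Field E] [Algebra K L] [Algebra K E]
    [Algebra L E] [IsScalarTower K L E] :
    Gal(E/K) →* Equiv.Perm (Gal(E/K) ⧸ galSubgroup K L E) :=
  MulAction.toPermHom Gal(E/K) (Gal(E/K) ⧸ galSubgroup K L E)

/-- A regular subgroup of `Perm X`: it has the same size as `X` and acts transitively on `X`. -/
def IsRegularSubgroup {X : Type*} (N : Subgroup (Equiv.Perm X)) : Prop :=
  Nat.card N = Nat.card X ∧ ∀ x y : X, ∃ η ∈ N, η x = y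

/-- The subgroup `N` of `Perm X` is stable under `σ ∗ η = λ(σ) η λ(σ)⁻¹`, i.e. it is normalized
by the image of `G` under left translation. -/
def IsGStable {K L E : Type*} [Field K] [Field L] [Field E] [Algebra K L] [Algebra K E]
    [Algebra L E] [IsScalarTower K L E]
    (N : Subgroup (Equiv.Perm (Gal(E/K) ⧸ galSubgroup K L E))) : Prop :=
  ∀ σ : Gal(E/K), ∀ η ∈ N, leftTranslation K L E σ * η * (leftTranslation K L E σ)⁻¹ ∈ N

/-- The action `σ ∗ η = λ(σ) η λ(σ)⁻¹` of `G` on a `G`-stable subgroup `N` of `Perm X`. -/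
def conjAct {K L E : Type*} [Field K] [Field L] [Field E] [Algebra K L] [Algebra K E]
    [Algebra L E] [IsScalarTower K L E]
    {N : Subgroup (Equiv.Perm (Gal(E/K) ⧸ galSubgroup K L E))} (hN : IsGStable N) :
    Gal(E/K) →* MulAut N where
  toFun σ :=
    { toFun := fun η =>
        ⟨leftTranslation K L E σ * η * (leftTranslation K L E σ)⁻¹, hN σ η η.2⟩
      invFun := fun η =>
        ⟨leftTranslation K L E σ⁻¹ * η * (leftTranslation K L E σ⁻¹)⁻¹, hN σ⁻¹ η η.2⟩
      left_inv := fun η => by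
        apply Subtype.ext
        simp only [map_inv]
        group
      right_inv := fun η => by
        apply Subtype.ext
        simp only [map_inv]
        group
      map_mul' := fun η θ => by
        apply Subtype.ext
        simp only [Subgroup.coe_mul]
        group }
  map_one' := by
    ext1 η
    apply Subtype.ext
    simp
  map_mul' σ τ := by
    ext1 η
    apply Subtype.ext
    simp [mul_assoc]

theorem conjAct_coe {K L E : Type*} [Field K] [Field L] [Field E] [Algebra K L] [Algebra K E]
    [Algebra L E] [IsScalarTower K L E]
    {N : Subgroup (Equiv.Perm (Gal(E/K) ⧸ galSubgroup K L E))} (hN : IsGStable N)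
    (σ : Gal(E/K)) (η : N) :
    ((conjAct hN σ η : N) : Equiv.Perm (Gal(E/K) ⧸ galSubgroup K L E)) =
      leftTranslation K L E σ * η * (leftTranslation K L E σ)⁻¹ := rfl

/-! Both directions read the fixed algebra through characters. Each character of N restricts to a
K-algebra map from the fixed points of M[N] to M. For N finite abelian with enough roots of unity in
M, these are all such maps, each arising once, and Γ acts on them by composition; an isomorphism of
fixed algebras therefore transports one character Γ-set to the other (`fixedEval_injective`,
`fixedEval_surjective`). Conversely, the Fourier transform identifies M[N] with the functions on the
characters and the fixed points with the equivariant functions, which depend only on the Γ-set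
(`charTransform_bijective`, `mem_fixedAlgebra_iff_charLift`). Hopf–Galois structures reduce to this:
a commutative fixed algebra forces N abelian, and enlarging E to M leaves the fixed algebra
unchanged up to isomorphism. -/

/-! ### Artin independence and traces into the fixed algebra -/

section GaloisTrace

variable {K M N : Type*} [Field K] [Field M] [Algebra K M] [Group N]

/-- Artin's independence of the elements of the Galois group. -/
theorem eq_zero_of_forall_sum_galois_mul_eq_zero [Fintype Gal(M/K)]
    (v : Gal(M/K) → M) (h : ∀ c : M, ∑ g, g c * v g = 0) (g : Gal(M/K)) : v g = 0 := by
  have hli : LinearIndependent M (fun g : Gal(M/K) => ((g : M →* M) : M → M)) :=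
    (linearIndependent_monoidHom M M).comp (fun g : Gal(M/K) => (g : M →* M)) (by
      intro a b hab
      ext x
      exact DFunLike.congr_fun hab x)
  rw [Fintype.linearIndependent_iff] at hli
  refine hli v ?_ g
  funext c
  simpa [Finset.sum_apply, mul_comm] using h c

theorem eq_zero_of_forall_sum_galois_smul_eq_zero [Fintype Gal(M/K)]
    (v : Gal(M/K) → MonoidAlgebra M N) (h : ∀ c : M, ∑ g, g c • v g = 0) (g : Gal(M/K)) :
    v g = 0 := by
  ext η
  refine eq_zero_of_forall_sum_galois_mul_eq_zero (fun g => (v g).coeff η) (fun c => ?_) g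
  have := congrArg (fun x : MonoidAlgebra M N => x.coeff η) (h c)
  simpa [MonoidAlgebra.coeff_sum, Finsupp.finsetSum_apply] using this

theorem groupAlgebraAct_mul_apply (φ : Gal(M/K) →* MulAut N) (g h : Gal(M/K))
    (x : MonoidAlgebra M N) :
    groupAlgebraAct φ (g * h) x = groupAlgebraAct φ g (groupAlgebraAct φ h x) := by
  induction x using MonoidAlgebra.induction_linear with
  | zero => simp
  | add x y hx hy => simp [hx, hy]
  | single η a => simp [groupAlgebraAct_single]

theorem groupAlgebraAct_smul (φ : Gal(M/K) →* MulAut N) (g : Gal(M/K)) (c : M)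
    (x : MonoidAlgebra M N) :
    groupAlgebraAct φ g (c • x) = g c • groupAlgebraAct φ g x := by
  induction x using MonoidAlgebra.induction_linear with
  | zero => simp
  | add x y hx hy => simp [hx, hy]
  | single η a => simp [groupAlgebraAct_single]

theorem coeff_groupAlgebraAct (φ : Gal(M/K) →* MulAut N) (g : Gal(M/K)) (x : MonoidAlgebra M N)
    (η : N) : (groupAlgebraAct φ g x).coeff (φ g η) = g (x.coeff η) := by
  classical
  induction x using MonoidAlgebra.induction_linear with
  | zero => simp
  | add x y hx hy => simp [hx, hy]
  | single θ a =>
    simp only [groupAlgebraAct_single, MonoidAlgebra.coeff_single, Finsupp.single_apply,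
      EmbeddingLike.apply_eq_iff_eq]
    split_ifs <;> simp

/-- The sum of the Galois conjugates of an element of the group algebra is a fixed point. -/
noncomputable def fixedTrace [Fintype Gal(M/K)] (φ : Gal(M/K) →* MulAut N)
    (x : MonoidAlgebra M N) : fixedAlgebra φ :=
  ⟨∑ g, groupAlgebraAct φ g x, (mem_fixedAlgebra φ _).2 fun h => by
    rw [map_sum]
    simp_rw [← groupAlgebraAct_mul_apply]
    exact Fintype.sum_equiv (Equiv.mulLeft h) _ _ fun _ => rfl⟩

theorem coe_fixedTrace_smul [Fintype Gal(M/K)] (φ : Gal(M/K) →* MulAut N) (c : M)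
    (x : MonoidAlgebra M N) :
    (fixedTrace φ (c • x) : MonoidAlgebra M N) = ∑ g, g c • groupAlgebraAct φ g x := by
  simp [fixedTrace, groupAlgebraAct_smul]

/-- If the fixed points of the group algebra commute, then the group algebra is commutative. -/
theorem commute_of_fixedAlgebra_commute [Finite Gal(M/K)] (φ : Gal(M/K) →* MulAut N)
    (h : ∀ x y : fixedAlgebra φ, x * y = y * x) (x y : MonoidAlgebra M N) : x * y = y * x := by
  have := Fintype.ofFinite Gal(M/K)
  have act_one (z : MonoidAlgebra M N) : groupAlgebraAct φ 1 z = z := by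
    induction z using MonoidAlgebra.induction_linear with
    | zero => simp
    | add x y hx hy => simp [hx, hy]
    | single η a => simp [groupAlgebraAct_single]
  have aux (w : MonoidAlgebra M N) (hw : ∀ y : fixedAlgebra φ, (y : MonoidAlgebra M N) * w = w * y)
      (y : MonoidAlgebra M N) : y * w = w * y := by
    -- Commuting with the trace of c • y, for every c, lets Artin independence separate the
    -- conjugates of y; the term at 1 is y itself.
    have key := eq_zero_of_forall_sum_galois_smul_eq_zero
      (fun g : Gal(M/K) => groupAlgebraAct φ g y * w - w * groupAlgebraAct φ g y) (fun c => by
        have := hw (fixedTrace φ (c • y))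
        rw [coe_fixedTrace_smul, Finset.sum_mul, Finset.mul_sum] at this
        simp only [smul_mul_assoc, mul_smul_comm] at this
        simp only [smul_sub, Finset.sum_sub_distrib, this, sub_self]) 1
    simpa [act_one, sub_eq_zero] using key
  refine aux y (fun x' => ?_) x
  exact (aux x' (fun y' => congrArg Subtype.val (h y' x')) y).symm

theorem mul_comm_of_fixedAlgebra_commute [Finite Gal(M/K)] (φ : Gal(M/K) →* MulAut N)
    (h : ∀ x y : fixedAlgebra φ, x * y = y * x) (η θ : N) : η * θ = θ * η := by
  have := commute_of_fixedAlgebra_commute φ h (MonoidAlgebra.single η 1) (MonoidAlgebra.single θ 1)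
  simp only [MonoidAlgebra.single_mul_single, mul_one] at this
  exact MonoidAlgebra.of_injective (R := M) this

end GaloisTrace

/-! ### Characters as points of the fixed algebra, and the Fourier transform -/

section Characters

variable {K M N : Type*} [Field K] [Field M] [Algebra K M]

/-- The algebra homomorphism `M[N] → M` that extends a character of `N`. -/
noncomputable def charLift [Group N] (χ : N →* Mˣ) : MonoidAlgebra M N →ₐ[M] M :=
  MonoidAlgebra.lift M M N ((Units.coeHom M).comp χ)

@[simp]
theorem charLift_single [Group N] (χ : N →* Mˣ) (η : N) (a : M) :
    charLift χ (MonoidAlgebra.single η a) = a * χ η := by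
  simp [charLift]

theorem charLift_dualAct_groupAlgebraAct [Group N] (φ : Gal(M/K) →* MulAut N) (g : Gal(M/K))
    (χ : N →* Mˣ) (x : MonoidAlgebra M N) :
    charLift (dualAct φ g χ) (groupAlgebraAct φ g x) = g (charLift χ x) := by
  induction x using MonoidAlgebra.induction_linear with
  | zero => simp
  | add x y hx hy => simp [hx, hy]
  | single η a =>
    rw [groupAlgebraAct_single, charLift_single, charLift_single, dualAct_apply, map_mul,
      ← MulAut.mul_apply, ← map_mul]
    simp

/-- The Fourier transform: evaluation at all characters, on the group algebra. -/
noncomputable def charTransform (M N : Type*) [Field M] [Group N] :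
    MonoidAlgebra M N →ₐ[M] ((N →* Mˣ) → M) :=
  AlgHom.pi (R := M) charLift

@[simp]
theorem charTransform_apply [Group N] (x : MonoidAlgebra M N) (χ : N →* Mˣ) :
    charTransform M N x χ = charLift χ x := rfl

/-- The `K`-algebra homomorphism `M[N]^Γ → M` given by a character. -/
noncomputable def fixedEval [Group N] (φ : Gal(M/K) →* MulAut N) (χ : N →* Mˣ) : fixedAlgebra φ →ₐ[K] M :=
  ((charLift χ).restrictScalars K).comp (fixedAlgebra φ).val

theorem fixedEval_apply [Group N] (φ : Gal(M/K) →* MulAut N) (χ : N →* Mˣ) (x : fixedAlgebra φ) :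
    fixedEval φ χ x = charLift χ (x : MonoidAlgebra M N) := rfl

theorem fixedEval_dualAct [Group N] (φ : Gal(M/K) →* MulAut N) (g : Gal(M/K)) (χ : N →* Mˣ) :
    fixedEval φ (dualAct φ g χ) = (g : M →ₐ[K] M).comp (fixedEval φ χ) := by
  ext x
  have hx := (mem_fixedAlgebra φ _).1 x.2 g
  calc charLift (dualAct φ g χ) (x : MonoidAlgebra M N)
      = charLift (dualAct φ g χ) (groupAlgebraAct φ g x) := by rw [hx]
    _ = _ := charLift_dualAct_groupAlgebraAct φ g χ _

/-- Traces of c • η, with c varying, are enough fixed points: Artin independence recovers χ η from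
its values on them. -/
theorem fixedEval_injective [Group N] [Finite Gal(M/K)] (φ : Gal(M/K) →* MulAut N) :
    Function.Injective (fixedEval φ) := by
  have := Fintype.ofFinite Gal(M/K)
  intro χ ψ h
  ext η
  have key := eq_zero_of_forall_sum_galois_mul_eq_zero
    (fun g : Gal(M/K) => charLift χ (groupAlgebraAct φ g (MonoidAlgebra.single η 1)) -
      charLift ψ (groupAlgebraAct φ g (MonoidAlgebra.single η 1))) (fun c => by
      have h1 := DFunLike.congr_fun h (fixedTrace φ (c • MonoidAlgebra.single η 1))
      rw [fixedEval_apply, fixedEval_apply, coe_fixedTrace_smul, map_sum, map_sum, ← sub_eq_zero,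
        ← Finset.sum_sub_distrib] at h1
      simpa only [map_smul, smul_eq_mul, ← mul_sub] using h1) 1
  simpa [groupAlgebraAct_single, sub_eq_zero] using key

variable [CommGroup N] [Finite N]

/-- Enough roots of unity make characters separate points of N, so evaluations at elements of N are
distinct characters of the dual group, hence linearly independent by Dedekind. -/
theorem charTransform_injective [HasEnoughRootsOfUnity M (Monoid.exponent N)] :
    Function.Injective (charTransform M N) := by
  have hli : LinearIndependent M
      (fun η : N => (fun χ : N →* Mˣ => ((χ η : Mˣ) : M))) :=
    (linearIndependent_monoidHom (N →* Mˣ) M).comp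
      (fun η : N => (Units.coeHom M).comp (MonoidHom.eval η)) (by
        intro a b hab
        by_contra hne
        obtain ⟨χ, hχ⟩ := CommGroup.exists_apply_ne_one_of_hasEnoughRootsOfUnity N M
          (a := a / b) (by rwa [ne_eq, div_eq_one])
        apply hχ
        have : ((χ a : Mˣ) : M) = χ b := DFunLike.congr_fun hab χ
        rw [map_div, Units.ext this, div_self'])
  rw [injective_iff_map_eq_zero]
  intro x hx
  have := Fintype.ofFinite N
  rw [Fintype.linearIndependent_iff] at hli
  ext η
  refine hli (fun η => x.coeff η) ?_ η
  funext χ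
  have h := congrFun hx χ
  rw [charTransform_apply, charLift, MonoidAlgebra.lift_apply, Finsupp.sum_fintype _ _ (by simp)] at h
  simpa using h

theorem charTransform_bijective [HasEnoughRootsOfUnity M (Monoid.exponent N)] :
    Function.Bijective (charTransform M N) := by
  obtain ⟨e⟩ := CommGroup.monoidHom_mulEquiv_of_hasEnoughRootsOfUnity N M
  have : Finite (N →* Mˣ) := Finite.of_equiv N e.symm
  have := Fintype.ofFinite N
  have := Fintype.ofFinite (N →* Mˣ)
  let c : MonoidAlgebra M N ≃ₗ[M] (N →₀ M) := MonoidAlgebra.coeffLinearEquiv M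
  have : FiniteDimensional M (MonoidAlgebra M N) := Module.Finite.equiv c.symm
  have hd : Module.finrank M (MonoidAlgebra M N) = Module.finrank M ((N →* Mˣ) → M) := by
    rw [c.finrank_eq, Module.finrank_finsupp_self, Module.finrank_fintype_fun_eq_card,
      Fintype.card_congr e.toEquiv]
  exact ⟨charTransform_injective, (LinearMap.injective_iff_surjective_of_finrank_eq_finrank hd
    (f := (charTransform M N).toLinearMap)).1 charTransform_injective⟩

theorem fixedEval_surjective [CharZero K] [FiniteDimensional K M] [IsGalois K M]
    [HasEnoughRootsOfUnity M (Monoid.exponent N)] (φ : Gal(M/K) →* MulAut N) :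
    Function.Surjective (fixedEval φ) := by
  intro f
  obtain ⟨e⟩ := CommGroup.monoidHom_mulEquiv_of_hasEnoughRootsOfUnity N M
  have : Finite (N →* Mˣ) := Finite.of_equiv N e.symm
  have := Fintype.ofFinite (N →* Mˣ)
  -- The polynomial q kills x because every character kills q(x). So f x is a conjugate of some
  -- χ(x), and the conjugating automorphism is absorbed into χ.
  have pointwise (x : fixedAlgebra φ) : ∃ χ, f x = fixedEval φ χ x := by
    let q : Polynomial K := ∏ χ : N →* Mˣ, minpoly K (fixedEval φ χ x)
    have hq : Polynomial.aeval x q = 0 := by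
      apply Subtype.ext
      apply charTransform_injective
      funext χ
      have : fixedEval φ χ (Polynomial.aeval x q) = 0 := by
        rw [← Polynomial.aeval_algHom_apply, map_prod]
        exact Finset.prod_eq_zero (Finset.mem_univ χ) (minpoly.aeval _ _)
      simpa [fixedEval_apply] using this
    have hf : Polynomial.aeval (f x) q = 0 := by
      rw [Polynomial.aeval_algHom_apply, hq, map_zero]
    rw [map_prod, Finset.prod_eq_zero_iff] at hf
    obtain ⟨χ, -, hχ⟩ := hf
    obtain ⟨g, hg⟩ := (isConjRoot_iff_exists_algEquiv).1
      ((isConjRoot_iff_aeval_eq_zero (Algebra.IsIntegral.isIntegral _)).2 hχ).symm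
    exact ⟨dualAct φ g χ, by rw [fixedEval_dualAct]; exact hg.symm⟩
  -- One χ must serve all x: over the infinite field K, a space is not a finite union of proper
  -- subspaces.
  obtain ⟨χ, hχ⟩ := Subspace.exists_eq_top_of_iUnion_eq_univ
    (p := fun χ => LinearMap.eqLocus f.toLinearMap (fixedEval φ χ).toLinearMap)
    (Set.eq_univ_of_forall fun x => Set.mem_iUnion.2 (pointwise x))
  refine ⟨χ, AlgHom.ext fun x => ?_⟩
  have : x ∈ LinearMap.eqLocus f.toLinearMap (fixedEval φ χ).toLinearMap := hχ ▸ Submodule.mem_top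
  exact this.symm

/-- `x` is a fixed point if and only if its Fourier transform is equivariant. -/
theorem mem_fixedAlgebra_iff_charLift [HasEnoughRootsOfUnity M (Monoid.exponent N)]
    (φ : Gal(M/K) →* MulAut N) (x : MonoidAlgebra M N) :
    x ∈ fixedAlgebra φ ↔ ∀ g χ, charLift (dualAct φ g χ) x = g (charLift χ x) := by
  rw [mem_fixedAlgebra]
  refine forall_congr' fun g => ⟨fun h χ => ?_, fun h => ?_⟩
  · rw [← charLift_dualAct_groupAlgebraAct, h]
  · apply charTransform_injective
    funext χ
    obtain ⟨ψ, rfl⟩ := (dualAct φ g).surjective χ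
    rw [charTransform_apply, charTransform_apply, charLift_dualAct_groupAlgebraAct, h]

end Characters

theorem Subalgebra.nonempty_algEquiv_of_mem_iff {K A B : Type*} [CommSemiring K] [Semiring A]
    [Semiring B] [Algebra K A] [Algebra K B] (S : Subalgebra K A) (T : Subalgebra K B)
    (f : A →ₐ[K] B) (hf : Function.Injective f) (hS : ∀ x, x ∈ S ↔ f x ∈ T)
    (hT : ∀ y ∈ T, ∃ x, f x = y) : Nonempty (S ≃ₐ[K] T) := by
  have : S.map f = T := by
    ext y
    rw [Subalgebra.mem_map]
    refine ⟨?_, fun hy => ?_⟩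
    · rintro ⟨x, hx, rfl⟩
      exact (hS x).1 hx
    · obtain ⟨x, rfl⟩ := hT y hy
      exact ⟨x, (hS x).2 hy, rfl⟩
  exact ⟨(S.equivMapOfInjective f hf).trans (Subalgebra.equivOfEq _ _ this)⟩

/-! ### The classification for abelian Γ-groups -/

section Classification

variable {K M : Type*} [Field K] [Field M] [Algebra K M]
  {N₁ N₂ : Type*} [CommGroup N₁] [Finite N₁] [CommGroup N₂] [Finite N₂]

theorem isomorphicGSets_dualAct_of_algEquiv [CharZero K] [FiniteDimensional K M] [IsGalois K M]
    [HasEnoughRootsOfUnity M (Monoid.exponent N₁)]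
    [HasEnoughRootsOfUnity M (Monoid.exponent N₂)] (φ₁ : Gal(M/K) →* MulAut N₁)
    (φ₂ : Gal(M/K) →* MulAut N₂) (e : fixedAlgebra φ₁ ≃ₐ[K] fixedAlgebra φ₂) :
    IsomorphicGSets (dualAct φ₁) (dualAct φ₂) := by
  let ε₁ := Equiv.ofBijective _ ⟨fixedEval_injective φ₁, fixedEval_surjective φ₁⟩
  let ε₂ := Equiv.ofBijective _ ⟨fixedEval_injective φ₂, fixedEval_surjective φ₂⟩
  refine ⟨(ε₁.trans (e.arrowCongr AlgEquiv.refl)).trans ε₂.symm, fun g χ => ?_⟩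
  have h₂ (ψ) : fixedEval φ₂ (ε₂.symm ψ) = ψ := ε₂.apply_symm_apply ψ
  apply fixedEval_injective φ₂
  rw [fixedEval_dualAct]
  simp only [Equiv.trans_apply, h₂]
  ext x
  exact DFunLike.congr_fun (fixedEval_dualAct φ₁ g χ) (e.symm x)

theorem nonempty_algEquiv_of_isomorphicGSets_dualAct
    [HasEnoughRootsOfUnity M (Monoid.exponent N₁)]
    [HasEnoughRootsOfUnity M (Monoid.exponent N₂)] (φ₁ : Gal(M/K) →* MulAut N₁)
    (φ₂ : Gal(M/K) →* MulAut N₂) (h : IsomorphicGSets (dualAct φ₁) (dualAct φ₂)) :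
    Nonempty (fixedAlgebra φ₁ ≃ₐ[K] fixedAlgebra φ₂) := by
  obtain ⟨f, hf⟩ := h
  let F₁ := AlgEquiv.ofBijective (charTransform M N₁) charTransform_bijective
  let F₂ := AlgEquiv.ofBijective (charTransform M N₂) charTransform_bijective
  -- Fourier transform, relabelling of characters along `f`, inverse transform.
  let Φ : MonoidAlgebra M N₁ ≃ₐ[M] MonoidAlgebra M N₂ :=
    (F₁.trans (AlgEquiv.piCongrLeft M (fun _ => M) f)).trans F₂.symm
  have hΦ (x χ) : charLift (f χ) (Φ x) = charLift χ x := by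
    have h₂ : charTransform M N₂ (Φ x) = AlgEquiv.piCongrLeft M (fun _ => M) f (F₁ x) :=
      F₂.apply_symm_apply _
    rw [← charTransform_apply, h₂]
    exact Equiv.piCongrLeft_apply_apply (fun _ => M) f (F₁ x) χ
  refine Subalgebra.nonempty_algEquiv_of_mem_iff _ _
    ((Φ : MonoidAlgebra M N₁ →ₐ[M] MonoidAlgebra M N₂).restrictScalars K) Φ.injective
    (fun x => ?_) (fun y _ => Φ.surjective y)
  change _ ↔ Φ x ∈ _
  rw [mem_fixedAlgebra_iff_charLift, mem_fixedAlgebra_iff_charLift]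
  refine forall_congr' fun g => ?_
  rw [← f.forall_congr_right]
  simp only [← hf, hΦ]

theorem nonempty_algEquiv_fixedAlgebra_iff [CharZero K] [FiniteDimensional K M] [IsGalois K M]
    (φ₁ : Gal(M/K) →* MulAut N₁)
    (φ₂ : Gal(M/K) →* MulAut N₂)
    (hζ : ∃ ζ : M, IsPrimitiveRoot ζ (Nat.lcm (Monoid.exponent N₁) (Monoid.exponent N₂))) :
    Nonempty (fixedAlgebra φ₁ ≃ₐ[K] fixedAlgebra φ₂) ↔
      IsomorphicGSets (dualAct φ₁) (dualAct φ₂) := by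
  have : NeZero (Nat.lcm (Monoid.exponent N₁) (Monoid.exponent N₂)) :=
    ⟨Nat.lcm_ne_zero Monoid.exponent_ne_zero_of_finite Monoid.exponent_ne_zero_of_finite⟩
  have : HasEnoughRootsOfUnity M (Nat.lcm (Monoid.exponent N₁) (Monoid.exponent N₂)) :=
    ⟨hζ, inferInstance⟩
  have : HasEnoughRootsOfUnity M (Monoid.exponent N₁) :=
    .of_dvd M (Nat.dvd_lcm_left _ (Monoid.exponent N₂))
  have : HasEnoughRootsOfUnity M (Monoid.exponent N₂) :=
    .of_dvd M (Nat.dvd_lcm_right (Monoid.exponent N₁) _)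
  exact ⟨fun ⟨e⟩ => isomorphicGSets_dualAct_of_algEquiv φ₁ φ₂ e,
    nonempty_algEquiv_of_isomorphicGSets_dualAct φ₁ φ₂⟩

end Classification

/-! ### Enlarging the Galois extension -/

section BaseChange

variable {K E M N : Type*} [Field K] [Field E] [Field M] [Algebra K E] [Algebra K M] [Algebra E M]
  [IsScalarTower K E M] [Group N]

theorem groupAlgebraAct_comp_restrictNormalHom [Normal K E] (φ : Gal(E/K) →* MulAut N)
    (γ : Gal(M/K)) (x : MonoidAlgebra E N) :
    groupAlgebraAct (φ.comp (AlgEquiv.restrictNormalHom E)) γ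
        (MonoidAlgebra.mapAlgHom N (IsScalarTower.toAlgHom K E M) x) =
      MonoidAlgebra.mapAlgHom N (IsScalarTower.toAlgHom K E M)
        (groupAlgebraAct φ (AlgEquiv.restrictNormalHom E γ) x) := by
  induction x using MonoidAlgebra.induction_linear with
  | zero => simp
  | add x y hx hy => simp only [map_add, hx, hy]
  | single η a =>
    have h := AlgEquiv.restrictNormal_commutes γ E a
    simp only [MonoidAlgebra.mapAlgHom_single, groupAlgebraAct_single]
    exact congrArg (MonoidAlgebra.single _) h.symm

/-- Enlarging the field does not change the fixed points: `E[N]^G ≃ M[N]^Γ`, where `Γ` acts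
on `N` through restriction. -/
theorem nonempty_algEquiv_fixedAlgebra_comp_restrictNormalHom [FiniteDimensional K M]
    [IsGalois K M] [IsGalois K E] (φ : Gal(E/K) →* MulAut N) :
    Nonempty (fixedAlgebra φ ≃ₐ[K]
      fixedAlgebra (φ.comp (AlgEquiv.restrictNormalHom (K₁ := M) E))) := by
  have : FiniteDimensional E M := FiniteDimensional.right K E M
  have : IsGalois E M := IsGalois.tower_top_of_isGalois K E M
  have hinj : Function.Injective
      (MonoidAlgebra.mapAlgHom N (IsScalarTower.toAlgHom K E M)) := by
    intro x y hxy
    ext η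
    have := congrArg (fun z : MonoidAlgebra M N => z.coeff η) hxy
    simpa using this
  refine Subalgebra.nonempty_algEquiv_of_mem_iff _ _
    (MonoidAlgebra.mapAlgHom N (IsScalarTower.toAlgHom K E M)) hinj (fun x => ?_) (fun y hy => ?_)
  · rw [mem_fixedAlgebra, mem_fixedAlgebra,
      (AlgEquiv.restrictNormalHom_surjective (F := K) (K₁ := E) M).forall]
    refine forall_congr' fun γ => ?_
    rw [groupAlgebraAct_comp_restrictNormalHom, hinj.eq_iff]
  · rw [mem_fixedAlgebra] at hy
    -- Gal(M/E) restricts trivially to E, so it acts trivially on N and must fix each coefficient of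
    -- y.
    have hmem (η : N) : y.coeff η ∈ Set.range (algebraMap E M) := by
      rw [IsGalois.mem_range_algebraMap_iff_fixed]
      intro δ
      have hδ : AlgEquiv.restrictNormalHom E (δ.restrictScalars K) = 1 := by
        ext a
        apply (algebraMap E M).injective
        exact (AlgEquiv.restrictNormal_commutes (δ.restrictScalars K) E a).trans (δ.commutes a)
      have h := coeff_groupAlgebraAct (φ.comp (AlgEquiv.restrictNormalHom E))
        (δ.restrictScalars K) y η
      rw [hy, MonoidHom.comp_apply, hδ] at h
      simpa using h.symm
    choose c hc using hmem
    refine ⟨∑ η ∈ y.coeff.support, MonoidAlgebra.single η (c η), ?_⟩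
    rw [map_sum]
    simp only [MonoidAlgebra.mapAlgHom_single, IsScalarTower.coe_toAlgHom', hc]
    exact y.sum_coeff_single

end BaseChange

theorem mainTheorem4 (K M : Type*) [Field K] [CharZero K]
    [Field M] [Algebra K M] [FiniteDimensional K M] [IsGalois K M] :
    -- `M` plays the role of `Ẽ`, and `Γ = Gal(M/K)`.
    -- Abelian `Γ`-groups `N₁`, `N₂`.
    (∀ (N₁ : Type*) (N₂ : Type*) [CommGroup N₁] [Finite N₁] [CommGroup N₂] [Finite N₂]
        (φ₁ : Gal(M/K) →* MulAut N₁) (φ₂ : Gal(M/K) →* MulAut N₂),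
      (∃ ζ : M, IsPrimitiveRoot ζ (Nat.lcm (Monoid.exponent N₁) (Monoid.exponent N₂))) →
      (Nonempty (fixedAlgebra φ₁ ≃ₐ[K] fixedAlgebra φ₂) ↔
        IsomorphicGSets (dualAct φ₁) (dualAct φ₂))) ∧
    -- Commutative Hopf-Galois structures on `L/K`; `E` is the Galois closure of `L/K`, and `Γ`
    -- acts on `Nᵢ` through the restriction map `Γ → G = Gal(E/K)`.
    (∀ (L : Type*) (E : Type*) [Field L] [Field E] [Algebra K L] [Algebra K E] [Algebra L E]
        [IsScalarTower K L E] [FiniteDimensional K L] [IsGalois K E] [IsNormalClosure K L E]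
        [Algebra E M] [IsScalarTower K E M]
        (N₁ N₂ : Subgroup (Equiv.Perm (Gal(E/K) ⧸ galSubgroup K L E)))
        (_ : IsRegularSubgroup N₁) (_ : IsRegularSubgroup N₂)
        (h₁ : IsGStable N₁) (h₂ : IsGStable N₂),
      (∀ x y : fixedAlgebra (conjAct h₁), x * y = y * x) →
      (∀ x y : fixedAlgebra (conjAct h₂), x * y = y * x) →
      (∃ ζ : M, IsPrimitiveRoot ζ (Nat.lcm (Monoid.exponent N₁) (Monoid.exponent N₂))) →
      (Nonempty (fixedAlgebra (conjAct h₁) ≃ₐ[K] fixedAlgebra (conjAct h₂)) ↔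
        IsomorphicGSets
          (dualAct ((conjAct h₁).comp (AlgEquiv.restrictNormalHom (K₁ := M) E)))
          (dualAct ((conjAct h₂).comp (AlgEquiv.restrictNormalHom (K₁ := M) E))))) := by
  refine ⟨fun N₁ N₂ _ _ _ _ φ₁ φ₂ hζ => nonempty_algEquiv_fixedAlgebra_iff φ₁ φ₂ hζ, ?_⟩
  intro L E _ _ _ _ _ _ _ _ _ _ _ N₁ N₂ _ _ h₁ h₂ hc₁ hc₂ hζ
  have : FiniteDimensional K E := FiniteDimensional.left K E M
  -- Built on the existing group structure, so that the fixed algebras and actions keep their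
  -- meaning.
  let _ : CommGroup N₁ :=
    { (inferInstance : Group N₁) with mul_comm := mul_comm_of_fixedAlgebra_commute _ hc₁ }
  let _ : CommGroup N₂ :=
    { (inferInstance : Group N₂) with mul_comm := mul_comm_of_fixedAlgebra_commute _ hc₂ }
  obtain ⟨e₁⟩ := nonempty_algEquiv_fixedAlgebra_comp_restrictNormalHom (M := M) (conjAct h₁)
  obtain ⟨e₂⟩ := nonempty_algEquiv_fixedAlgebra_comp_restrictNormalHom (M := M) (conjAct h₂)
  refine Iff.trans ?_ (nonempty_algEquiv_fixedAlgebra_iff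
    ((conjAct h₁).comp (AlgEquiv.restrictNormalHom (K₁ := M) E))
    ((conjAct h₂).comp (AlgEquiv.restrictNormalHom (K₁ := M) E)) hζ)
  exact ⟨fun ⟨e⟩ => ⟨(e₁.symm.trans e).trans e₂⟩, fun ⟨e⟩ => ⟨(e₁.trans e).trans e₂.symm⟩⟩
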